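/- Let $V$ be a finite set of points in the Euclidean plane in general position: no three points of $V$ are collinear and no four are cocircular. Write $|ab|$ for the Euclidean distance. For $v\in V$ let $N_v=\{u\in V: |uv|\le 1\}$ and let $LDT(v)$ be the Delaunay triangulation of $N_v$: $(a,b)$ with $a\ne b$ is an edge if there is a disk $D$ with $N_v\cap\partial D=\{a,b\}$ and $N_v\cap \mathrm{int}(D)=\emptyset$, and three distinct points of $N_v$ form a triangular face if the interior of their circumdisk contains no point of $N_v$. Two segments cross if they are not collinear and their relative interiors have a common point. All points of $V$ run the following algorithm $PLDG$ in parallel. (1) Each $v\in V$ initializes $E(v)$ as the set of all edges of $LDT(v)$ that are incident on $v$. For each triangular face $\Delta(u,v,w)$ of $LDT(v)$ with $\angle uvw>\pi/3$, it broadcasts its own location together with the center of the circumcircle of that face, to all points in $N_v$. (2) For each center $c$ that $v$ receives from a point $x\in N_v$ such that the circle $C$ with center $c$ through $x$ contains exactly two points of $N_v$, let $p$ be the one of these two points different from $x$, and let $arc=\{w\in C: |vw|>1\}$. Point $v$ chooses an arbitrary point $z'\in arc$ with $|xz'|\le 1$ or $|pz'|\le 1$. For each edge $(v,y)$ in $E(v)$,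 it chooses an arbitrary disk $D$ with $N_v\cap\partial D=\{v,y\}$ and $N_v\cap\mathrm{int}(D)=\emptyset$; if $arc\subseteq\mathrm{int}(D)$ and the segment $vy$ crosses at least one of the segments $xz'$ and $pz'$, then $v$ removes $(v,y)$ from $E(v)$. Let $E(v)$, $v\in V$, denote the final edge sets, and let $PLDG(V)$ be the graph with vertex set $V$ and edge set $\bigcup_{v\in V}E(v)$. Then, whatever choices are made by the points, $PLDG(V)$ is consistent: for any two distinct points $v$ and $y$ of $V$, $(v,y)$ is an edge in $E(v)$ if and only if $(v,y)$ is an edge in $E(y)$. -/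

import Mathlib

namespace PlaneLDG

/-- The Euclidean plane. -/
abbrev Plane : Type := EuclideanSpace ℝ (Fin 2)

/-- General position: no three points of `V` are collinear and no four points of `V` are
cocircular. -/
structure GeneralPosition (V : Finset Plane) : Prop where
  not_collinear : ∀ a ∈ V, ∀ b ∈ V, ∀ c ∈ V, a ≠ b → a ≠ c → b ≠ c →
    ¬ Collinear ℝ ({a, b, c} : Set Plane)
  not_cocircular : ∀ a ∈ V, ∀ b ∈ V, ∀ c ∈ V, ∀ d ∈ V,
    a ≠ b → a ≠ c → a ≠ d → b ≠ c → b ≠ d → c ≠ d →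
    ¬ EuclideanGeometry.Cospherical ({a, b, c, d} : Set Plane)

/-- Two segments `ab` and `cd` cross: they are not collinear and some point lies in the relative
interior of both. -/
def Cross (a b c d : Plane) : Prop :=
  ¬ Collinear ℝ ({a, b, c, d} : Set Plane) ∧ (openSegment ℝ a b ∩ openSegment ℝ c d).Nonempty

/-- A disk, given by its center and its radius. -/
structure Disk where
  center : Plane
  radius : ℝ

/-- The boundary circle of a disk. -/
def Disk.boundary (D : Disk) : Set Plane := Metric.sphere D.center D.radius

/-- The interior of a disk. -/
def Disk.inner (D : Disk) : Set Plane := Metric.ball D.center D.radius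

/-- The disk `D(c; |cx|)` with center `c` that has `x` on its boundary. -/
noncomputable def diskThrough (c x : Plane) : Disk := ⟨c, dist c x⟩

/-- `D` certifies that `(a, b)` is a Delaunay edge of `N`: the only points of `N` on the boundary
of `D` are `a` and `b`, and no point of `N` is in the interior of `D`. -/
def IsDel (N : Set Plane) (a b : Plane) (D : Disk) : Prop :=
  N ∩ D.boundary = {a, b} ∧ N ∩ D.inner = ∅

/-- `(a, b)` is an edge of the Delaunay triangulation of the point set `N`. -/
def IsDelaunayEdge (N : Set Plane) (a b : Plane) : Prop :=
  a ≠ b ∧ ∃ D : Disk, IsDel N a b D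

/-- The triangle with vertices `a, b, c` is a triangular face of the Delaunay triangulation
of the point set `N` and `o` is the center of its circumcircle. -/
def IsDelaunayFace (N : Set Plane) (a b c o : Plane) : Prop :=
  a ∈ N ∧ b ∈ N ∧ c ∈ N ∧ a ≠ b ∧ a ≠ c ∧ b ≠ c ∧
    ∃ D : Disk, D.center = o ∧ a ∈ D.boundary ∧ b ∈ D.boundary ∧ c ∈ D.boundary ∧
      N ∩ D.inner = ∅

/-- The set `N_v` of all points of `V` at distance at most one from `v`. The Delaunay
triangulation of `nbhd V v` is `LDT(v)`. -/
def nbhd (V : Finset Plane) (v : Plane) : Set Plane := {u | u ∈ V ∧ dist u v ≤ 1}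

/-- Point `x` broadcasts the center `c` (together with its own location): `c` is the center of the
circumcircle of a triangular face `uxw` of `LDT(x)` whose angle at `x` is larger than `π / 3`. -/
def Broadcasts (V : Finset Plane) (x c : Plane) : Prop :=
  ∃ u w : Plane, IsDelaunayFace (nbhd V x) u x w c ∧ Real.pi / 3 < EuclideanGeometry.angle u x w

/-- Point `v` receives the center `c` from `x`, the circle with center `c` through `x` contains
exactly two points of `N_v`, and `p` is the one of these two points that is not `x`. -/
def Considers (V : Finset Plane) (v x c p : Plane) : Prop :=
  x ∈ nbhd V v ∧ Broadcasts V x c ∧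
    (nbhd V v ∩ (diskThrough c x).boundary).ncard = 2 ∧
    p ∈ (nbhd V v \ {x}) ∩ (diskThrough c x).boundary

/-- The arc of the circle with center `c` through `x` that is not contained in the unit disk
centered at `v`. -/
def arc (v x c : Plane) : Set Plane := (diskThrough c x).boundary \ Metric.closedBall v 1

/-- The arbitrary choices that are made when all points of `V` run the algorithm: when `v`
considers the center `c` received from `x`, it picks a point `z v x c` on the arc and, for each
edge `(v, y)`, a disk `del v x c y` that certifies this edge in `LDT(v)`. -/
structure Run (V : Finset Plane) where
  z : Plane → Plane → Plane → Plane
  del : Plane → Plane → Plane → Plane → Disk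
  z_spec : ∀ v ∈ V, ∀ x c p, Considers V v x c p →
    z v x c ∈ arc v x c ∧ (dist x (z v x c) ≤ 1 ∨ dist p (z v x c) ≤ 1)
  del_spec : ∀ v ∈ V, ∀ x c p y, Considers V v x c p → IsDelaunayEdge (nbhd V v) v y →
    IsDel (nbhd V v) v y (del v x c y)

/-- In the run `R`, point `v` removes the edge `(v, y)` when it considers the center `c` received
from `x`, where `p` is the other point of `N_v` on the circle. -/
def Run.Removes {V : Finset Plane} (R : Run V) (v y x c p : Plane) : Prop :=
  Considers V v x c p ∧ arc v x c ⊆ (R.del v x c y).inner ∧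
    (Cross v y x (R.z v x c) ∨ Cross v y p (R.z v x c))

/-- The edge set `E(v)` that `v` has computed at the end of the run `R`: the edges of `LDT(v)`
that are incident on `v`, except those that `v` has removed. (Whether a center makes `v` remove an
edge does not depend on the edges removed before, so the order of the steps is irrelevant.) -/
def Run.E {V : Finset Plane} (R : Run V) (v : Plane) : Set (Sym2 Plane) :=
  {e | ∃ y, e = s(v, y) ∧ IsDelaunayEdge (nbhd V v) v y ∧ ¬ ∃ x c p, R.Removes v y x c p}

end PlaneLDG

namespace PlaneLDG

open AffineMap (lineMap)

/-! By symmetry it is enough that an edge `vy` kept by `v` is also kept by `y`. There are two ways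
in which `y` could lack it, and in both `v` is shown to remove it too. If `vy` is not Delaunay in
`N_y`, a Delaunay triangle `yab` of `N_y` has its side `ab` crossing `vy`
(`exists_delaunay_triangle_crossing`). Exactly one of `a`, `b` is then adjacent to `v`, the angle at
`y` exceeds π/3, so `y` broadcasts the circumcenter and `v` removes the edge
(`Run.exists_removes_of_not_delaunay`). If the edge is Delaunay on both sides and one endpoint
removes it because of a center, the other endpoint considers the same center and removes it as well
(`Run.removes_symm`). The arbitrary choices are harmless: all points of the arc lie on one side of
the line `vy`, so the chosen point can be exchanged for the third triangle vertex. The main tool is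
the power of a point. The difference of two powers is affine, so when two segments cross, its signs
at three endpoints can force the sign at the fourth (`pw_lt_of_crossing`). The metric input is the
comparison of diagonals and opposite sides in `dist_add_dist_le_of_crossing`. -/

/-! ### Powers of points and signed areas. -/

/-- The power of the point `q` with respect to the circle with center `c` and squared radius `k`. -/
noncomputable def pw (c : Plane) (k : ℝ) (q : Plane) : ℝ := dist q c ^ 2 - k

/-- Twice the signed area of the triangle `abc`. -/
def orient (a b c : Plane) : ℝ := (b 0 - a 0) * (c 1 - a 1) - (b 1 - a 1) * (c 0 - a 0)

lemma dist_sq_eq (a b : Plane) : dist a b ^ 2 = (a 0 - b 0) ^ 2 + (a 1 - b 1) ^ 2 := by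
  rw [EuclideanSpace.dist_eq, Real.sq_sqrt (Finset.sum_nonneg fun _ _ => sq_nonneg _)]
  simp [Fin.sum_univ_two, Real.dist_eq, sq_abs]

lemma lineMap_coord (a b : Plane) (t : ℝ) (i : Fin 2) :
    (lineMap a b t : Plane) i = (1 - t) * a i + t * b i := by
  simp [AffineMap.lineMap_apply]; ring

lemma plane_ext {a b : Plane} (h0 : a 0 = b 0) (h1 : a 1 = b 1) : a = b := by
  ext i; fin_cases i <;> assumption

/-- Stewart's theorem. The quadratic term does not depend on the circle, so it cancels in a
difference of two powers. -/
lemma pw_lineMap (c : Plane) (k : ℝ) (a b : Plane) (t : ℝ) :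
    pw c k (lineMap a b t) =
      (1 - t) * pw c k a + t * pw c k b - t * (1 - t) * dist a b ^ 2 := by
  simp only [pw, dist_sq_eq, lineMap_coord]; ring

lemma orient_lineMap (u w a b : Plane) (t : ℝ) :
    orient u w (lineMap a b t) = (1 - t) * orient u w a + t * orient u w b := by
  simp only [orient, lineMap_coord]; ring

lemma orient_swap (a b c : Plane) : orient b a c = -orient a b c := by
  simp only [orient]; ring

lemma orient_self_left (a b : Plane) : orient a b a = 0 := by simp only [orient]; ring

lemma orient_self_right (a b : Plane) : orient a b b = 0 := by simp only [orient]; ring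

/-- The affine dependence of four points of the plane, applied to the affine function
`pw c k - pw c' k'`. -/
lemma pw_sub_orient (c c' : Plane) (k k' : ℝ) (v x y z : Plane) :
    (pw c k v - pw c' k' v) * orient x y z - (pw c k x - pw c' k' x) * orient v y z
      + (pw c k y - pw c' k' y) * orient v x z - (pw c k z - pw c' k' z) * orient v x y = 0 := by
  simp only [pw, dist_sq_eq, orient]; ring

lemma dist_sq_pos {v y : Plane} (h : v ≠ y) : 0 < dist v y ^ 2 := by
  have := dist_pos.2 h; positivity

lemma exists_lineMap_of_orient_eq_zero {v y q : Plane} (h : v ≠ y) (hq : orient v y q = 0) :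
    ∃ τ : ℝ, q = lineMap v y τ := by
  have hE : dist v y ^ 2 ≠ 0 := (dist_sq_pos h).ne'
  rw [dist_sq_eq] at hE
  simp only [orient] at hq
  refine ⟨((q 0 - v 0) * (y 0 - v 0) + (q 1 - v 1) * (y 1 - v 1)) /
    ((v 0 - y 0) ^ 2 + (v 1 - y 1) ^ 2), plane_ext ?_ ?_⟩
  · rw [lineMap_coord]; field_simp; linear_combination (-(y 1 - v 1)) * hq
  · rw [lineMap_coord]; field_simp; linear_combination (y 0 - v 0) * hq

lemma collinear_of_orient_eq_zero {v y q : Plane} (h : v ≠ y) (hq : orient v y q = 0) :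
    Collinear ℝ ({v, y, q} : Set Plane) := by
  obtain ⟨τ, rfl⟩ := exists_lineMap_of_orient_eq_zero h hq
  rw [collinear_iff_of_mem (p₀ := v) (by simp)]
  refine ⟨y - v, ?_⟩
  rintro p (rfl | rfl | rfl)
  · exact ⟨0, by simp⟩
  · exact ⟨1, by simp⟩
  · exact ⟨τ, by simp [AffineMap.lineMap_apply]⟩

lemma exists_convex_comb_eq_zero {α β : ℝ} (h : α * β ≤ 0) :
    ∃ s : ℝ, 0 ≤ s ∧ s ≤ 1 ∧ (1 - s) * α + s * β = 0 := by
  rcases eq_or_ne α 0 with rfl | hα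
  · exact ⟨0, le_rfl, zero_le_one, by simp⟩
  have hd : 0 < α * (α - β) := by nlinarith [sq_nonneg α, (sq_pos_of_ne_zero hα : 0 < α ^ 2)]
  have hne : α - β ≠ 0 := fun h0 => by simp [h0] at hd
  -- This is `α / (α - β)`, expanded by `α` so that the denominator is positive whatever the sign of
  -- `α`.
  refine ⟨α ^ 2 / (α * (α - β)), by positivity, ?_, ?_⟩
  · rw [div_le_one hd]; nlinarith
  · field_simp; ring

/-! ### Chords of a circle that cross a segment. -/

/-- If `v` and `y` are not inside a circle that contains a point of the open segment `vy` in its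
interior, then the line through `v` and `y` meets the disk only between `v` and `y`. -/
lemma exists_mem_segment_of_opposite {c v y q r : Plane} {k : ℝ} (hvy : v ≠ y)
    (hv : 0 ≤ pw c k v) (hy : 0 ≤ pw c k y) (hm : ∃ m ∈ openSegment ℝ v y, pw c k m < 0)
    (hq : pw c k q ≤ 0) (hr : pw c k r ≤ 0) (hqr : orient v y q * orient v y r ≤ 0) :
    ∃ s τ : ℝ, 0 ≤ s ∧ s ≤ 1 ∧ 0 ≤ τ ∧ τ ≤ 1 ∧
      (lineMap q r s : Plane) = lineMap v y τ ∧ (1 - s) * orient v y q + s * orient v y r = 0 := by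
  obtain ⟨s, hs0, hs1, hs⟩ := exists_convex_comb_eq_zero hqr
  obtain ⟨τ, hτ⟩ := exists_lineMap_of_orient_eq_zero (q := lineMap q r s) hvy
    (by rw [orient_lineMap, hs])
  rw [openSegment_eq_image_lineMap] at hm
  obtain ⟨_, ⟨μ, ⟨hμ0, hμ1⟩, rfl⟩, hμ⟩ := hm
  have hp : pw c k (lineMap v y τ) ≤ 0 := by
    rw [← hτ, pw_lineMap]
    nlinarith [mul_nonneg hs0 (sub_nonneg.2 hs1), sq_nonneg (dist q r),
      mul_nonneg (mul_nonneg hs0 (sub_nonneg.2 hs1)) (sq_nonneg (dist q r)),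
      mul_nonneg hs0 (neg_nonneg.2 hr), mul_nonneg (sub_nonneg.2 hs1) (neg_nonneg.2 hq)]
  rw [pw_lineMap] at hp hμ
  have hE := dist_sq_pos hvy
  generalize dist v y ^ 2 = E at *
  generalize pw c k v = A at *
  generalize pw c k y = B at *
  refine ⟨s, τ, hs0, hs1, ?_, ?_, hτ, hs⟩
  · by_contra! h
    -- For `τ < 0`, `v` lies between a point of the closed disk and a point of the open disk; strict
    -- convexity of the power would put `v` inside.
    have e : A * (μ - τ) = μ * ((1 - τ) * A + τ * B - τ * (1 - τ) * E)
      + (-τ) * ((1 - μ) * A + μ * B - μ * (1 - μ) * E) - μ * (-τ) * (μ - τ) * E := by ring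
    have h1 := mul_nonneg hv (by linarith : 0 ≤ μ - τ)
    have h2 := mul_nonneg hμ0.le (neg_nonneg.2 hp)
    have h3 := mul_pos (neg_pos.2 h) (neg_pos.2 hμ)
    have h4 : 0 < μ * (-τ) * (μ - τ) * E :=
      mul_pos (mul_pos (mul_pos hμ0 (neg_pos.2 h)) (by linarith)) hE
    linarith
  · by_contra! h
    have e : B * (τ - μ) = (1 - μ) * ((1 - τ) * A + τ * B - τ * (1 - τ) * E)
      + (τ - 1) * ((1 - μ) * A + μ * B - μ * (1 - μ) * E)
      - (1 - μ) * (τ - 1) * (τ - μ) * E := by ring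
    have h1 := mul_nonneg hy (by linarith : 0 ≤ τ - μ)
    have h2 := mul_nonneg (by linarith : 0 ≤ 1 - μ) (neg_nonneg.2 hp)
    have h3 := mul_pos (by linarith : 0 < τ - 1) (neg_pos.2 hμ)
    have h4 : 0 < (1 - μ) * (τ - 1) * (τ - μ) * E :=
      mul_pos (mul_pos (mul_pos (by linarith) (by linarith)) (by linarith)) hE
    linarith

/-- An affine function that is nonpositive at both ends of `vy` and positive at `a` is negative at
`z`, if the segments `vy` and `az` cross. -/
lemma pw_lt_of_crossing {v y a z c c' : Plane} {k k' : ℝ}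
    (h : (openSegment ℝ v y ∩ openSegment ℝ a z).Nonempty)
    (hv : pw c k v ≤ pw c' k' v) (hy : pw c k y ≤ pw c' k' y) (ha : pw c' k' a < pw c k a) :
    pw c k z < pw c' k' z := by
  simp only [openSegment_eq_image_lineMap] at h
  obtain ⟨m, ⟨t, ⟨ht0, ht1⟩, rfl⟩, s, ⟨hs0, hs1⟩, hs⟩ := h
  have e1 := pw_lineMap c k v y t
  have e2 := pw_lineMap c' k' v y t
  rw [← hs, pw_lineMap] at e1 e2
  have h1 := mul_nonneg (by linarith : 0 ≤ 1 - t) (sub_nonneg.2 hv)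
  have h2 := mul_nonneg ht0.le (sub_nonneg.2 hy)
  have h3 := mul_pos (by linarith : 0 < 1 - s) (sub_pos.2 ha)
  have h4 : 0 < s * (pw c' k' z - pw c k z) := by linarith
  exact sub_pos.1 ((pos_iff_pos_of_mul_pos h4).1 hs0)

lemma exists_pw_neg_of_crossing {v y a z c : Plane} {k : ℝ}
    (h : (openSegment ℝ v y ∩ openSegment ℝ a z).Nonempty) (haz : a ≠ z)
    (ha : pw c k a = 0) (hz : pw c k z = 0) : ∃ m ∈ openSegment ℝ v y, pw c k m < 0 := by
  obtain ⟨m, hm, hm'⟩ := h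
  refine ⟨m, hm, ?_⟩
  rw [openSegment_eq_image_lineMap] at hm'
  obtain ⟨s, ⟨hs0, hs1⟩, rfl⟩ := hm'
  rw [pw_lineMap, ha, hz]
  have := mul_pos (mul_pos hs0 (by linarith : 0 < 1 - s)) (dist_sq_pos haz)
  linarith

/-- Two points of a circle on different sides of `vy` are joined by a segment crossing `vy`. -/
lemma crossing_of_opposite {c v y a z : Plane} {k : ℝ} (hvy : v ≠ y)
    (hv : 0 ≤ pw c k v) (hy : 0 ≤ pw c k y) (hm : ∃ m ∈ openSegment ℝ v y, pw c k m < 0)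
    (ha : pw c k a = 0) (hz : pw c k z = 0) (haz : orient v y a * orient v y z < 0) :
    (openSegment ℝ v y ∩ openSegment ℝ a z).Nonempty := by
  obtain ⟨s, τ, hs0, hs1, hτ0, hτ1, e, e'⟩ :=
    exists_mem_segment_of_opposite hvy hv hy hm ha.le hz.le haz.le
  have hne : a ≠ z := by rintro rfl; nlinarith [mul_self_nonneg (orient v y a)]
  have hs0' : 0 < s := hs0.lt_of_ne (by
    rintro rfl
    have : orient v y a = 0 := by linarith
    simp [this] at haz)
  have hs1' : s < 1 := hs1.lt_of_ne (by
    rintro rfl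
    have : orient v y z = 0 := by linarith
    simp [this] at haz)
  have hp : pw c k (lineMap a z s) < 0 := by
    rw [pw_lineMap, ha, hz]
    have := mul_pos (mul_pos hs0' (by linarith : 0 < 1 - s)) (dist_sq_pos hne)
    linarith
  rw [e] at hp
  simp only [openSegment_eq_image_lineMap]
  refine ⟨lineMap v y τ, ⟨τ, ⟨hτ0.lt_of_ne ?_, hτ1.lt_of_ne ?_⟩, rfl⟩, s, ⟨hs0', hs1'⟩, e⟩
  · rintro rfl; simp at hp; linarith
  · rintro rfl; simp at hp; linarith

/-- The points of a circle that are outside a disk containing `v` and `y` are on the same side of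
the line `vy`. -/
lemma same_side_of_outside {c w v y q r : Plane} {k l : ℝ} (hvy : v ≠ y)
    (hv : 0 ≤ pw c k v) (hy : 0 ≤ pw c k y) (hm : ∃ m ∈ openSegment ℝ v y, pw c k m < 0)
    (hwv : pw w l v ≤ 0) (hwy : pw w l y ≤ 0)
    (hq : pw c k q = 0) (hr : pw c k r = 0) (hwq : 0 < pw w l q) (hwr : 0 < pw w l r) :
    0 < orient v y q * orient v y r := by
  by_contra! h
  obtain ⟨s, τ, hs0, hs1, hτ0, hτ1, e, -⟩ :=
    exists_mem_segment_of_opposite hvy hv hy hm hq.le hr.le h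
  have e1 := pw_lineMap c k v y τ
  have e2 := pw_lineMap w l v y τ
  rw [← e, pw_lineMap] at e1 e2
  have h1 := mul_nonneg (by linarith : 0 ≤ 1 - τ) (by linarith : 0 ≤ pw c k v - pw w l v)
  have h2 := mul_nonneg hτ0 (by linarith : 0 ≤ pw c k y - pw w l y)
  rw [hq, hr] at e1
  rcases hs0.eq_or_lt with rfl | hs0'
  · nlinarith
  · have h3 := mul_nonneg (by linarith : 0 ≤ 1 - s) hwq.le
    have h4 := mul_pos hs0' hwr
    linarith

/-- This is the circle with diameter `vx`. If `|vx| ≤ 1`, every point at distance more than 1 from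
`v` is outside it. -/
lemma pw_eq_inner (v x q : Plane) :
    pw (midpoint ℝ v x) (dist v x ^ 2 / 4) q =
      (dist q v ^ 2 + dist q x ^ 2 - dist v x ^ 2) / 2 := by
  have h := pw_lineMap q 0 v x (1 / 2)
  have hm : (lineMap v x (1 / 2 : ℝ) : Plane) = midpoint ℝ v x := by
    rw [midpoint, invOf_eq_inv, one_div]
  simp only [hm, pw] at h
  simp only [pw]
  rw [dist_comm q, dist_comm q v, dist_comm q x]
  linarith

/-! ### Delaunay edges and triangles. -/

/-- The circles through `v` and `y` form a pencil with parameter `τ`, in which `q` has power `f q -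
τ * orient y v q`. Points on one side of the line bound `τ` above, points on the other side bound it
below; `h` says that each lower bound is less than each upper bound. -/
lemma isDelaunayEdge_of_forall_pair {N : Set Plane} (hN : N.Finite) {v y : Plane} (hv : v ∈ N)
    (hy : y ∈ N) (hvy : v ≠ y) (hgen : ∀ q ∈ N, q ≠ v → q ≠ y → orient y v q ≠ 0)
    (h : ∀ a ∈ N, ∀ b ∈ N, 0 < orient y v a → orient y v b < 0 →
      orient y b a * dist v y ^ 2
        < -orient y v b * dist a y ^ 2 + orient y v a * dist b y ^ 2) :
    IsDelaunayEdge N y v := by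
  let f : Plane → ℝ := fun q => (q 0 - v 0) * (q 0 - y 0) + (q 1 - v 1) * (q 1 - y 1)
  let R : Plane → ℝ := fun q => f q / orient y v q
  classical
  obtain ⟨τ, hτl, hτr⟩ : ∃ τ : ℝ, (∀ b ∈ N, orient y v b < 0 → R b < τ) ∧
      ∀ a ∈ N, 0 < orient y v a → τ < R a := by
    obtain ⟨τ, h1, h2⟩ := Order.exists_between_finsets
      (lo := (hN.toFinset.filter fun b => orient y v b < 0).image R)
      (hi := (hN.toFinset.filter fun a => 0 < orient y v a).image R) (by
        simp only [Finset.mem_image, Finset.mem_filter, Set.Finite.mem_toFinset]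
        rintro _ ⟨b, ⟨hb, hb'⟩, rfl⟩ _ ⟨a, ⟨ha, ha'⟩, rfl⟩
        have h0 := h a ha b hb ha' hb'
        have e : f b / orient y v b = (-f b) / (-orient y v b) := by rw [neg_div_neg_eq]
        simp only [R, e]
        rw [div_lt_div_iff₀ (by linarith) ha']
        simp only [dist_sq_eq] at h0
        simp only [f]
        simp only [orient] at h0 ⊢
        linarith)
    refine ⟨τ, fun b hb hb' => h1 _ ?_, fun a ha ha' => h2 _ ?_⟩ <;>
      simp only [Finset.mem_image, Finset.mem_filter, Set.Finite.mem_toFinset]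
    · exact ⟨b, ⟨hb, hb'⟩, rfl⟩
    · exact ⟨a, ⟨ha, ha'⟩, rfl⟩
  let o : Plane := !₂[(v 0 + y 0) / 2 - τ / 2 * (v 1 - y 1), (v 1 + y 1) / 2 + τ / 2 * (v 0 - y 0)]
  have ho0 : o 0 = (v 0 + y 0) / 2 - τ / 2 * (v 1 - y 1) := rfl
  have ho1 : o 1 = (v 1 + y 1) / 2 + τ / 2 * (v 0 - y 0) := rfl
  have key : ∀ q, dist q o ^ 2 - dist v o ^ 2 = f q - τ * orient y v q := by
    intro q
    simp only [dist_sq_eq, ho0, ho1, f, orient]; ring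
  have hout : ∀ q ∈ N, q ≠ v → q ≠ y → dist v o < dist q o := by
    intro q hq hqv hqy
    refine lt_of_pow_lt_pow_left₀ 2 dist_nonneg (sub_pos.1 ?_)
    rw [key]
    rcases (hgen q hq hqv hqy).lt_or_gt with h0 | h0
    · have := hτl q hq h0
      rw [div_lt_iff_of_neg h0] at this
      linarith
    · have := hτr q hq h0
      rw [lt_div_iff₀ h0] at this
      linarith
  have hyo : dist y o = dist v o := by
    have := key y
    rw [orient_self_left] at this
    simp only [f, sub_self, mul_zero, add_zero] at this
    exact (pow_left_inj₀ dist_nonneg dist_nonneg two_ne_zero).1 (by linarith)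
  refine ⟨hvy.symm, ⟨o, dist v o⟩, ?_, ?_⟩
  · ext q
    simp only [Disk.boundary, Set.mem_inter_iff, Metric.mem_sphere, Set.mem_insert_iff,
      Set.mem_singleton_iff]
    constructor
    · rintro ⟨hq, hq'⟩
      by_contra! hne
      exact (hout q hq hne.2 hne.1).ne' hq'
    · rintro (rfl | rfl)
      · exact ⟨hy, hyo⟩
      · exact ⟨hv, rfl⟩
  · rw [Set.eq_empty_iff_forall_notMem]
    rintro q ⟨hq, hq'⟩
    simp only [Disk.inner, Metric.mem_ball] at hq'
    by_cases h1 : q = v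
    · subst h1; exact lt_irrefl _ hq'
    by_cases h2 : q = y
    · subst h2; exact hq'.ne hyo
    exact lt_asymm hq' (hout q hq h1 h2)

/-- If `yv` is not a Delaunay edge, then the Delaunay triangle at `y` in the direction of `v` has
a side that crosses `vy`. -/
lemma exists_delaunay_triangle_crossing {N : Set Plane} (hN : N.Finite) {v y : Plane} (hv : v ∈ N)
    (hy : y ∈ N) (hvy : v ≠ y) (hgen : ∀ q ∈ N, q ≠ v → q ≠ y → orient y v q ≠ 0)
    (h : ¬ IsDelaunayEdge N y v) :
    ∃ a ∈ N, ∃ b ∈ N, ∃ c, 0 < orient y v a ∧ orient y v b < 0 ∧ dist a c = dist y c ∧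
      dist b c = dist y c ∧ (∀ q ∈ N, dist y c ≤ dist q c) ∧
      (openSegment ℝ v y ∩ openSegment ℝ a b).Nonempty := by
  -- Under inversion at `y`, the chord joining the images of `a` and `b` meets the ray towards `v`
  -- at parameter `orient y b a / den (a, b)`. The farthest such chord is an edge of the hull of the
  -- images, so its circle through `y` is empty.
  let den : Plane × Plane → ℝ := fun p =>
    -orient y v p.2 * dist p.1 y ^ 2 + orient y v p.1 * dist p.2 y ^ 2
  let S : Set (Plane × Plane) := {p | p ∈ N ×ˢ N ∧ 0 < orient y v p.1 ∧ orient y v p.2 < 0}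
  have hne : ∀ {q}, orient y v q ≠ 0 → q ≠ y := by
    rintro q hq rfl; exact hq (orient_self_left _ _)
  have hden : ∀ p ∈ S, 0 < den p := by
    rintro p ⟨-, h1, h2⟩
    exact add_pos (mul_pos (neg_pos.2 h2) (dist_sq_pos (hne h1.ne')))
      (mul_pos h1 (dist_sq_pos (hne h2.ne)))
  have hV := dist_sq_pos hvy
  obtain ⟨p₀, hp₀, hp₀'⟩ : ∃ p ∈ S, den p ≤ orient y p.2 p.1 * dist v y ^ 2 := by
    by_contra! hc
    refine h (isDelaunayEdge_of_forall_pair hN hv hy hvy hgen fun a ha b hb ha' hb' => ?_)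
    exact hc (a, b) ⟨⟨ha, hb⟩, ha', hb'⟩
  obtain ⟨⟨a, b⟩, hab, hmax⟩ := Set.exists_max_image S (fun p => orient y p.2 p.1 / den p)
    ((hN.prod hN).subset fun p hp => hp.1) ⟨p₀, hp₀⟩
  have hD := hden _ hab
  obtain ⟨⟨ha, hb⟩, ha', hb'⟩ := hab
  simp only at ha hb ha' hb' hmax
  have hVs : den (a, b) ≤ orient y b a * dist v y ^ 2 := by
    have h1 := hmax p₀ hp₀
    rw [div_le_div_iff₀ (hden _ hp₀) hD] at h1
    have h2 := mul_le_mul_of_nonneg_right hp₀' hD.le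
    have h3 := mul_le_mul_of_nonneg_right h1 hV.le
    have h4 : den p₀ * den (a, b) ≤ den p₀ * (orient y b a * dist v y ^ 2) := by linarith
    exact le_of_mul_le_mul_left h4 (hden _ hp₀)
  have hdet : 0 < orient y b a := by
    by_contra! h0
    nlinarith
  have hleft : ∀ q ∈ N, 0 < orient y v q →
      0 ≤ orient y b a * dist q y ^ 2 - orient y b q * dist a y ^ 2 - orient y q a * dist b y ^ 2 := by
    intro q hq hq'
    have h1 := hmax (q, b) ⟨⟨hq, hb⟩, hq', hb'⟩
    rw [div_le_div_iff₀ (hden _ ⟨⟨hq, hb⟩, hq', hb'⟩) hD] at h1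
    refine nonneg_of_mul_nonneg_right (a := -orient y v b) ?_ (neg_pos.2 hb')
    have e : -orient y v b * (orient y b a * dist q y ^ 2 - orient y b q * dist a y ^ 2
        - orient y q a * dist b y ^ 2)
        = orient y b a * den (q, b) - orient y b q * den (a, b) := by
      simp only [den, dist_sq_eq, orient]; ring
    rw [e]; linarith
  have hright : ∀ q ∈ N, orient y v q < 0 →
      0 ≤ orient y b a * dist q y ^ 2 - orient y b q * dist a y ^ 2 - orient y q a * dist b y ^ 2 := by
    intro q hq hq'
    have h1 := hmax (a, q) ⟨⟨ha, hq⟩, ha', hq'⟩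
    rw [div_le_div_iff₀ (hden _ ⟨⟨ha, hq⟩, ha', hq'⟩) hD] at h1
    refine nonneg_of_mul_nonneg_right (a := orient y v a) ?_ ha'
    have e : orient y v a * (orient y b a * dist q y ^ 2 - orient y b q * dist a y ^ 2
        - orient y q a * dist b y ^ 2)
        = orient y b a * den (a, q) - orient y q a * den (a, b) := by
      simp only [den, dist_sq_eq, orient]; ring
    rw [e]; linarith
  have hvv : 0 ≤ orient y b a * dist v y ^ 2 - orient y b v * dist a y ^ 2
      - orient y v a * dist b y ^ 2 := by
    have e : orient y b v = -orient y v b := by simp only [orient]; ring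
    rw [e]; simp only [den] at hVs; linarith
  -- The circumcenter of `y`, `a`, `b`, by Cramer's rule.
  let c : Plane := !₂[y 0 + (dist a y ^ 2 * -(b 1 - y 1) + dist b y ^ 2 * (a 1 - y 1))
      / (2 * orient y b a),
    y 1 + (dist a y ^ 2 * (b 0 - y 0) - dist b y ^ 2 * (a 0 - y 0)) / (2 * orient y b a)]
  have hc0 : c 0 = y 0 + (dist a y ^ 2 * -(b 1 - y 1) + dist b y ^ 2 * (a 1 - y 1))
      / (2 * orient y b a) := rfl
  have hc1 : c 1 = y 1 + (dist a y ^ 2 * (b 0 - y 0) - dist b y ^ 2 * (a 0 - y 0))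
      / (2 * orient y b a) := rfl
  have key : ∀ q, orient y b a * (dist q c ^ 2 - dist y c ^ 2) =
      orient y b a * dist q y ^ 2 - orient y b q * dist a y ^ 2 - orient y q a * dist b y ^ 2 := by
    intro q
    rw [dist_sq_eq q c, dist_sq_eq y c, hc0, hc1, dist_sq_eq q y]
    have e1 : orient y b q = (b 0 - y 0) * (q 1 - y 1) - (b 1 - y 1) * (q 0 - y 0) := rfl
    have e2 : orient y q a = (q 0 - y 0) * (a 1 - y 1) - (q 1 - y 1) * (a 0 - y 0) := rfl
    rw [e1, e2]
    field_simp
    ring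
  have heq : ∀ q, orient y b a * dist q y ^ 2 - orient y b q * dist a y ^ 2
      - orient y q a * dist b y ^ 2 = 0 → dist q c = dist y c := by
    intro q hq
    rw [← key q] at hq
    have := (mul_eq_zero.1 hq).resolve_left hdet.ne'
    exact (pow_left_inj₀ dist_nonneg dist_nonneg two_ne_zero).1 (by linarith)
  have hle : ∀ q, 0 ≤ orient y b a * dist q y ^ 2 - orient y b q * dist a y ^ 2
      - orient y q a * dist b y ^ 2 → dist y c ≤ dist q c := by
    intro q hq
    rw [← key q] at hq
    have := nonneg_of_mul_nonneg_right hq hdet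
    exact (pow_le_pow_iff_left₀ dist_nonneg dist_nonneg two_ne_zero).1 (by linarith)
  have hac : dist a c = dist y c := heq a (by simp only [orient]; ring)
  have hbc : dist b c = dist y c := heq b (by simp only [orient]; ring)
  refine ⟨a, ha, b, hb, c, ha', hb', hac, hbc, fun q hq => ?_, ?_⟩
  · by_cases h1 : q = v
    · subst h1; exact hle _ hvv
    by_cases h2 : q = y
    · subst h2; exact le_rfl
    rcases (hgen q hq h1 h2).lt_or_gt with h0 | h0
    · exact hle q (hright q hq h0)
    · exact hle q (hleft q hq h0)
  · have hS : 0 < orient y v a - orient y v b := by linarith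
    set s := orient y v a / (orient y v a - orient y v b) with hs
    set τ := 1 - orient y b a / (orient y v a - orient y v b) with hτ
    have hs0 : 0 < s := div_pos ha' hS
    have hs1 : s < 1 := (div_lt_one hS).2 (by linarith)
    have hτ1 : τ < 1 := by have := div_pos hdet hS; linarith
    have hcomb : ∀ i, -orient y v b * a i + orient y v a * b i = orient y b a * v i
        + (orient y v a - orient y v b - orient y b a) * y i := by
      intro i
      fin_cases i <;> simp only [orient] <;> simp <;> ring
    have hm : (lineMap a b s : Plane) = lineMap v y τ := by
      have : ∀ i, (lineMap a b s : Plane) i = (lineMap v y τ : Plane) i := by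
        intro i
        rw [lineMap_coord, lineMap_coord, hs, hτ]
        field_simp
        linear_combination hcomb i
      exact plane_ext (this 0) (this 1)
    -- The crossing point is inside the circle, whereas on the line `vy` nothing from `v` outward
    -- is, since `y` is on the circle and `v` is not inside.
    have hτ0 : 0 < τ := by
      by_contra! h0
      have h1 : pw c (dist y c ^ 2) (lineMap a b s) < 0 := by
        have hab : a ≠ b := by rintro rfl; linarith
        have := mul_pos (mul_pos hs0 (by linarith : 0 < 1 - s)) (dist_sq_pos hab)
        rw [pw_lineMap, pw, pw, hac, hbc]; linarith
      rw [hm, pw_lineMap] at h1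
      have h2 : 0 ≤ pw c (dist y c ^ 2) v :=
        sub_nonneg.2 (pow_le_pow_left₀ dist_nonneg (hle v hvv) 2)
      have h3 : pw c (dist y c ^ 2) y = 0 := sub_self _
      have h4 := mul_nonneg (by linarith : 0 ≤ 1 - τ) h2
      have h5 := mul_nonneg (mul_nonneg (neg_nonneg.2 h0) (by linarith : 0 ≤ 1 - τ)) hV.le
      rw [h3] at h1
      linarith
    simp only [openSegment_eq_image_lineMap]
    exact ⟨_, ⟨τ, ⟨hτ0, hτ1⟩, rfl⟩, s, ⟨hs0, hs1⟩, hm⟩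

/-! ### Consequences of the unit distance bound. -/

lemma pw_le_zero {c q : Plane} (h : dist q c ≤ 1) : pw c 1 q ≤ 0 := by
  have := dist_nonneg (x := q) (y := c)
  simp only [pw]; nlinarith

lemma pw_pos {c q : Plane} (h : 1 < dist q c) : 0 < pw c 1 q := by
  simp only [pw]; nlinarith

/-- Split both diagonals at `m` and apply the triangle inequality twice. -/
lemma dist_add_dist_le_of_crossing {v y x z m : Plane} (h1 : m ∈ segment ℝ v y)
    (h2 : m ∈ segment ℝ x z) : dist x y + dist z v ≤ dist v y + dist x z := by
  rw [← dist_add_dist_of_mem_segment h1, ← dist_add_dist_of_mem_segment h2]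
  have := dist_triangle x m y
  have := dist_triangle z m v
  rw [dist_comm z m, dist_comm m v] at this
  linarith

lemma pw_zero_nonneg (c q : Plane) : 0 ≤ pw c 0 q := by
  simp only [pw, sub_zero]; exact sq_nonneg _

lemma pw_zero_self (c : Plane) : pw c 0 c = 0 := by simp [pw]

/-- If `|xy| > 1`, the point where `xz` meets the line `vy` cannot lie beyond `v`, by the circle,
nor beyond `y`, by the unit disk around `x`. So the segments meet, and `|xy| + |zv| ≤ |vy| + |xz| ≤
2` is contradicted. -/
lemma dist_le_one_of_opposite {v y x z c : Plane} {k : ℝ} (hvy : v ≠ y)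
    (hx : pw c k x = 0) (hz : pw c k z = 0) (hv : 0 ≤ pw c k v) (hy : pw c k y < 0)
    (hvy1 : dist v y ≤ 1) (hxv : dist x v ≤ 1) (hxz : dist x z ≤ 1)
    (hzv : 1 < dist z v) (hs : orient v y x * orient v y z ≤ 0) : dist x y ≤ 1 := by
  by_contra! hxy
  obtain ⟨s, hs0, hs1, hs⟩ := exists_convex_comb_eq_zero hs
  obtain ⟨τ, hτ⟩ := exists_lineMap_of_orient_eq_zero (q := lineMap x z s) hvy
    (by rw [orient_lineMap, hs])
  have hE := dist_sq_pos hvy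
  have hc := pw_lineMap c k v y τ
  rw [← hτ, pw_lineMap, hx, hz] at hc
  have hd := pw_lineMap x 1 v y τ
  rw [← hτ, pw_lineMap] at hd
  have hss := mul_nonneg (mul_nonneg hs0 (by linarith : 0 ≤ 1 - s)) (sq_nonneg (dist x z))
  have hτ0 : 0 ≤ τ := by
    by_contra! h
    have h1 := mul_nonneg (by linarith : 0 ≤ 1 - τ) hv
    have h2 := mul_pos_of_neg_of_neg h hy
    have h3 := mul_pos (mul_pos (neg_pos.2 h) (by linarith : 0 < 1 - τ)) hE
    linarith
  have hτ1 : τ ≤ 1 := by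
    by_contra! h
    have h1 := mul_nonneg (by linarith : 0 ≤ τ - 1)
      (neg_nonneg.2 (pw_le_zero (by rwa [dist_comm]) : pw x 1 v ≤ 0))
    have h2 := mul_pos (by linarith : 0 < τ) (pw_pos (by rwa [dist_comm]) : 0 < pw x 1 y)
    have h3 := mul_pos (mul_pos (by linarith : 0 < τ) (by linarith : 0 < τ - 1)) hE
    have h4 := mul_nonneg (by linarith : 0 ≤ 1 - s)
      (neg_nonneg.2 (pw_le_zero (by simp) : pw x 1 x ≤ 0))
    have h5 := mul_nonneg hs0
      (neg_nonneg.2 (pw_le_zero (by rwa [dist_comm]) : pw x 1 z ≤ 0))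
    linarith
  have hm1 : (lineMap x z s : Plane) ∈ segment ℝ v y := by
    rw [hτ, segment_eq_image_lineMap]; exact ⟨τ, ⟨hτ0, hτ1⟩, rfl⟩
  have hm2 : (lineMap x z s : Plane) ∈ segment ℝ x z := by
    rw [segment_eq_image_lineMap]; exact ⟨s, ⟨hs0, hs1⟩, rfl⟩
  have := dist_add_dist_le_of_crossing hm1 hm2
  linarith

/-- Let `xz` be a chord of a circle that does not contain `v` in its interior, and let `vy` be a
chord of a disk that contains `z`, but not `x`. If `x` is close to `v` and `z`, whereas `z` is
far from `v` and `x` is far from `y`, then `y` is not inside the circle. -/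
lemma pw_nonneg_of_far {v y x z c d : Plane} {k l : ℝ} (hvy : v ≠ y)
    (hx : pw c k x = 0) (hz : pw c k z = 0) (hv : 0 ≤ pw c k v)
    (hDv : pw d l v = 0) (hDy : pw d l y = 0) (hDx : 0 ≤ pw d l x) (hDz : pw d l z < 0)
    (hvy1 : dist v y ≤ 1) (hxv : dist x v ≤ 1) (hxz : dist x z ≤ 1)
    (hzv : 1 < dist z v) (hxy : 1 < dist x y) : 0 ≤ pw c k y := by
  by_contra! hy
  have hs : 0 < orient v y x * orient v y z := by
    by_contra! hs
    exact hxy.not_ge (dist_le_one_of_opposite hvy hx hz hv hy hvy1 hxv hxz hzv hs)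
  -- The sign `σ` normalizes the side of `vy` that contains both `x` and `z`.
  obtain ⟨σ, hσx, hσz⟩ : ∃ σ : ℝ, σ * orient v y x < 0 ∧ σ * orient v y z < 0 := by
    rcases pos_and_pos_or_neg_and_neg_of_mul_pos hs with h | h
    · exact ⟨-1, by linarith, by linarith⟩
    · exact ⟨1, by linarith, by linarith⟩
  have rel : ∀ (c c' : Plane) (k k' : ℝ),
      (pw c k v - pw c' k' v) * (σ * orient x y z)
        - (pw c k x - pw c' k' x) * (σ * orient v y z)
        + (pw c k y - pw c' k' y) * (σ * orient v x z)
        + (pw c k z - pw c' k' z) * (σ * orient v y x) = 0 := by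
    intro c c' k k'
    have h := pw_sub_orient c c' k k' v x y z
    have e : orient v x y = -orient v y x := by simp only [orient]; ring
    rw [e] at h
    linear_combination σ * h
  generalize σ * orient v y z = a at *
  generalize σ * orient v y x = b at *
  generalize σ * orient v x z = Q at *
  generalize σ * orient x y z = P at *
  have ha := (neg_pos.2 hσz).le
  have h0 := pw_zero_nonneg
  -- The signs of `P` and `Q` give the possible positions of the four points, up to degeneracy: `xy`
  -- crosses `vz`; `x` lies in the triangle `vyz`; `z` lies in the triangle `vxy`; `vx` crosses
  -- `yz`. In each, a suitable pair of circles in `rel` gives a contradiction.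
  rcases le_or_gt P 0 with hP | hP <;> rcases le_or_gt 0 Q with hQ | hQ
  · have r := rel d c l k
    rw [hDv, hDy, hx, hz] at r
    have h1 := mul_nonneg hv (neg_nonneg.2 hP)
    have h2 := mul_nonneg (neg_pos.2 hy).le hQ
    have h3 := mul_nonneg hDx ha
    have h4 := mul_pos_of_neg_of_neg hDz hσx
    linarith
  · have r := rel d x l 0
    rw [hDv, hDy, pw_zero_self] at r
    have h1 := mul_nonneg (h0 x v) (neg_nonneg.2 hP)
    have h2 := mul_nonneg (h0 x y) (neg_pos.2 hQ).le
    have h3 := mul_nonneg hDx ha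
    have h4 := mul_pos_of_neg_of_neg (by linarith [h0 x z] : pw d l z - pw x 0 z < 0) hσx
    linarith
  · have r := rel v z 1 0
    rw [pw_zero_self] at r
    have hv1 := pw_le_zero (c := v) (q := v) (by simp)
    have hx1 := pw_le_zero hxv
    have hy1 := pw_le_zero (c := v) (q := y) (by rwa [dist_comm])
    have h1 := mul_nonneg (by linarith [h0 z v] : 0 ≤ -(pw v 1 v - pw z 0 v)) hP.le
    have h2 := mul_nonneg (by linarith [h0 z y] : 0 ≤ -(pw v 1 y - pw z 0 y)) hQ
    have h3 := mul_nonneg (by linarith [h0 z x] : 0 ≤ -(pw v 1 x - pw z 0 x)) ha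
    have h4 := mul_pos (pw_pos hzv) (neg_pos.2 hσx)
    linarith
  · have r := rel (midpoint ℝ v x) c (dist v x ^ 2 / 4) k
    simp only [pw_eq_inner, dist_self, hx, hz, dist_comm x v] at r
    have hd1 : dist v x ^ 2 ≤ 1 := pow_le_one₀ dist_nonneg (by rwa [dist_comm])
    have hd2 : 1 < dist z v ^ 2 := one_lt_pow₀ hzv two_ne_zero
    have hd3 : 1 < dist y x ^ 2 := one_lt_pow₀ (by rwa [dist_comm]) two_ne_zero
    have hd4 := sq_nonneg (dist z x)
    have hd5 := sq_nonneg (dist y v)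
    have h1 := mul_nonneg hv hP.le
    have h2 := mul_pos (by linarith :
      0 < (dist y v ^ 2 + dist y x ^ 2 - dist v x ^ 2) / 2 - pw c k y) (neg_pos.2 hQ)
    have h3 := mul_pos (by linarith :
      0 < (dist z v ^ 2 + dist z x ^ 2 - dist v x ^ 2) / 2) (neg_pos.2 hσx)
    linarith

/-- The ray from `y` to `v` lies inside the angle `ayb`, and the angle `vyb` exceeds π/3 because
`bv` is the strictly longest side of the triangle `vyb`. -/
lemma pi_div_three_lt_angle {v y a b : Plane}
    (h : (openSegment ℝ v y ∩ openSegment ℝ a b).Nonempty) (hvy : dist v y ≤ 1)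
    (hby : dist b y ≤ 1) (hbv : 1 < dist b v) : Real.pi / 3 < EuclideanGeometry.angle a y b := by
  by_contra! hle
  simp only [openSegment_eq_image_lineMap] at h
  obtain ⟨_, ⟨τ, ⟨hτ0, hτ1⟩, rfl⟩, s, ⟨hs0, hs1⟩, hs⟩ := h
  have hcos : 1 / 2 ≤ Real.cos (EuclideanGeometry.angle a y b) := by
    rw [← Real.cos_pi_div_three]
    exact Real.cos_le_cos_of_nonneg_of_le_pi (InnerProductGeometry.angle_nonneg _ _)
      (by linarith [Real.pi_pos]) hle
  have hin := InnerProductGeometry.cos_angle_mul_norm_mul_norm (a - y) (b - y)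
  change Real.cos (EuclideanGeometry.angle a y b) * _ = _ at hin
  have hV : (1 - τ) • (v - y) = (1 - s) • (a - y) + s • (b - y) := by
    have : (lineMap a b s : Plane) - y = lineMap v y τ - y := by rw [hs]
    simp only [AffineMap.lineMap_apply_module] at this
    have e1 : (1 - s) • a + s • b - y = (1 - s) • (a - y) + s • (b - y) := by module
    have e2 : (1 - τ) • v + τ • y - y = (1 - τ) • (v - y) := by module
    rw [← e1, ← e2, this]
  have hn := norm_add_le ((1 - s) • (a - y)) (s • (b - y))
  rw [← hV, norm_smul, norm_smul, norm_smul, Real.norm_of_nonneg (by linarith),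
    Real.norm_of_nonneg (by linarith), Real.norm_of_nonneg hs0.le] at hn
  have hi : (1 - τ) * inner ℝ (v - y) (b - y) =
      (1 - s) * inner ℝ (a - y) (b - y) + s * ‖b - y‖ ^ 2 := by
    rw [← real_inner_smul_left, hV, inner_add_left, real_inner_smul_left, real_inner_smul_left,
      real_inner_self_eq_norm_sq]
  have hsub := norm_sub_sq_real (v - y) (b - y)
  rw [sub_sub_sub_cancel_right, ← dist_eq_norm v b, dist_comm v b] at hsub
  rw [dist_eq_norm] at hvy hby
  have hA := norm_nonneg (a - y)
  have hB := norm_nonneg (b - y)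
  have hV0 := norm_nonneg (v - y)
  have h1 := mul_le_mul_of_nonneg_right hcos (mul_nonneg hA hB)
  rw [hin] at h1
  have h2 := mul_le_mul_of_nonneg_left h1 (by linarith : 0 ≤ 1 - s)
  have h3 := mul_le_mul_of_nonneg_right hn hB
  have h4 := mul_nonneg hs0.le (sq_nonneg ‖b - y‖)
  have h5 : (1 - τ) * (‖v - y‖ * ‖b - y‖ / 2) ≤ (1 - τ) * inner ℝ (v - y) (b - y) := by
    rw [hi]; linarith
  have h6 := le_of_mul_le_mul_left h5 (by linarith)
  have h7 : 1 < dist b v ^ 2 := one_lt_pow₀ hbv two_ne_zero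
  rcases le_total ‖v - y‖ ‖b - y‖ with h | h <;> nlinarith

/-! ### The definitions in terms of powers; general position. -/

lemma mem_boundary_diskThrough {c x q : Plane} :
    q ∈ (diskThrough c x).boundary ↔ pw c (dist c x ^ 2) q = 0 := by
  simp only [diskThrough, Disk.boundary, Metric.mem_sphere, pw, sub_eq_zero]
  exact (pow_left_inj₀ dist_nonneg dist_nonneg two_ne_zero).symm

lemma mem_arc {v x c q : Plane} :
    q ∈ arc v x c ↔ pw c (dist c x ^ 2) q = 0 ∧ 1 < dist q v := by
  simp [arc, mem_boundary_diskThrough]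

lemma IsDel.pw_left {N : Set Plane} {a b : Plane} {D : Disk} (h : IsDel N a b D) :
    pw D.center (D.radius ^ 2) a = 0 := by
  have : a ∈ N ∩ D.boundary := by rw [h.1]; simp
  rw [pw, Metric.mem_sphere.1 this.2, sub_self]

lemma IsDel.pw_right {N : Set Plane} {a b : Plane} {D : Disk} (h : IsDel N a b D) :
    pw D.center (D.radius ^ 2) b = 0 := by
  have : b ∈ N ∩ D.boundary := by rw [h.1]; simp
  rw [pw, Metric.mem_sphere.1 this.2, sub_self]

lemma IsDel.radius_nonneg {N : Set Plane} {a b : Plane} {D : Disk} (h : IsDel N a b D) :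
    0 ≤ D.radius := by
  have : a ∈ N ∩ D.boundary := by rw [h.1]; simp
  rw [← Metric.mem_sphere.1 this.2]; exact dist_nonneg

lemma IsDel.mem_inner {N : Set Plane} {a b q : Plane} {D : Disk} (h : IsDel N a b D) :
    q ∈ D.inner ↔ pw D.center (D.radius ^ 2) q < 0 := by
  rw [Disk.inner, Metric.mem_ball, pw, sub_neg, pow_lt_pow_iff_left₀ dist_nonneg h.radius_nonneg
    two_ne_zero]

lemma IsDel.pw_nonneg {N : Set Plane} {a b q : Plane} {D : Disk} (h : IsDel N a b D)
    (hq : q ∈ N) : 0 ≤ pw D.center (D.radius ^ 2) q := by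
  by_contra! h0
  have : q ∈ N ∩ D.inner := ⟨hq, h.mem_inner.2 h0⟩
  rw [h.2] at this
  exact this

lemma IsDel.pw_pos {N : Set Plane} {a b q : Plane} {D : Disk} (h : IsDel N a b D)
    (hq : q ∈ N) (ha : q ≠ a) (hb : q ≠ b) : 0 < pw D.center (D.radius ^ 2) q := by
  refine (h.pw_nonneg hq).lt_of_ne' fun h0 => ?_
  have : q ∈ N ∩ D.boundary :=
    ⟨hq, (pow_left_inj₀ dist_nonneg h.radius_nonneg two_ne_zero).1 (sub_eq_zero.1 h0)⟩
  rw [h.1] at this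
  rcases this with h1 | h1
  exacts [ha h1, hb h1]

lemma IsDel.symm {N : Set Plane} {a b : Plane} {D : Disk} (h : IsDel N a b D) :
    IsDel N b a D := by rwa [IsDel, Set.pair_comm]

lemma IsDelaunayEdge.symm {N : Set Plane} {a b : Plane} (h : IsDelaunayEdge N a b) :
    IsDelaunayEdge N b a := ⟨h.1.symm, h.2.imp fun _ => IsDel.symm⟩

lemma IsDelaunayEdge.right_mem {N : Set Plane} {a b : Plane} (h : IsDelaunayEdge N a b) :
    b ∈ N := by
  obtain ⟨-, D, hD, -⟩ := h
  have : b ∈ N ∩ D.boundary := by rw [hD]; simp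
  exact this.1

lemma IsDelaunayFace.pw_nonneg {N : Set Plane} {u x w c q : Plane}
    (h : IsDelaunayFace N u x w c) (hq : q ∈ N) : 0 ≤ pw c (dist c x ^ 2) q := by
  obtain ⟨-, -, -, -, -, -, D, rfl, -, hx, -, hD⟩ := h
  rw [Disk.boundary, Metric.mem_sphere] at hx
  have h1 : q ∉ D.inner := fun h => by
    have : q ∈ N ∩ D.inner := ⟨hq, h⟩
    rw [hD] at this; exact this
  rw [Disk.inner, Metric.mem_ball, not_lt, ← hx] at h1
  rw [pw, dist_comm D.center x]
  exact sub_nonneg.2 (pow_le_pow_left₀ dist_nonneg h1 2)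

lemma IsDelaunayFace.pw_eq_zero {N : Set Plane} {u x w c : Plane}
    (h : IsDelaunayFace N u x w c) :
    pw c (dist c x ^ 2) u = 0 ∧ pw c (dist c x ^ 2) w = 0 := by
  obtain ⟨-, -, -, -, -, -, D, rfl, hu, hx, hw, -⟩ := h
  rw [Disk.boundary, Metric.mem_sphere] at hu hx hw
  simp [pw, dist_comm D.center x, hu, hx, hw]

lemma GeneralPosition.orient_ne_zero {V : Finset Plane} (hV : GeneralPosition V) {a b c : Plane}
    (ha : a ∈ V) (hb : b ∈ V) (hc : c ∈ V) (hab : a ≠ b) (hca : c ≠ a) (hcb : c ≠ b) :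
    orient a b c ≠ 0 :=
  fun h => hV.not_collinear a ha b hb c hc hab hca.symm hcb.symm (collinear_of_orient_eq_zero hab h)

lemma GeneralPosition.eq_of_pw_eq_zero {V : Finset Plane} (hV : GeneralPosition V)
    {x p z q o : Plane} {k : ℝ} (hx : x ∈ V) (hp : p ∈ V) (hz : z ∈ V) (hq : q ∈ V)
    (hxp : x ≠ p) (hxz : x ≠ z) (hpz : p ≠ z) (ox : pw o k x = 0) (op : pw o k p = 0)
    (oz : pw o k z = 0) (oq : pw o k q = 0) : q = x ∨ q = p ∨ q = z := by
  by_contra! h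
  refine hV.not_cocircular x hx p hp z hz q hq hxp hxz h.1.symm hpz h.2.1.symm h.2.2.symm
    ⟨o, √k, ?_⟩
  have : ∀ r, pw o k r = 0 → dist r o = √k := fun r hr => by
    rw [← sub_eq_zero.1 hr, Real.sqrt_sq dist_nonneg]
  rintro r (rfl | rfl | rfl | rfl) <;> exact this _ (by assumption)

/-- The circle already carries `x`, `p` and the point `z` outside `N_v`; as no four points are
cocircular, it meets `N_v` in `x` and `p` only. -/
lemma considers_of_circle {V : Finset Plane} (hV : GeneralPosition V) {v x p z c : Plane}
    (hx : x ∈ nbhd V v) (hp : p ∈ nbhd V v) (hz : z ∈ V) (hxp : x ≠ p) (hzv : 1 < dist z v)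
    (hcp : pw c (dist c x ^ 2) p = 0) (hcz : pw c (dist c x ^ 2) z = 0)
    (hB : Broadcasts V x c) : Considers V v x c p := by
  have hcx : pw c (dist c x ^ 2) x = 0 := by simp [pw, dist_comm]
  have hpc := mem_boundary_diskThrough.2 hcp
  refine ⟨hx, hB, ?_, ⟨hp, hxp.symm⟩, hpc⟩
  have : nbhd V v ∩ (diskThrough c x).boundary = {x, p} := by
    ext q
    constructor
    · rintro ⟨hq, hq'⟩
      have hne : ∀ r ∈ nbhd V v, r ≠ z := by rintro r hr rfl; exact hzv.not_ge hr.2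
      rcases hV.eq_of_pw_eq_zero hx.1 hp.1 hz hq.1 hxp (hne x hx) (hne p hp) hcx hcp hcz
        (mem_boundary_diskThrough.1 hq') with h | h | h
      exacts [Or.inl h, Or.inr h, (hne q hq h).elim]
    · rintro (rfl | rfl)
      · exact ⟨hx, mem_boundary_diskThrough.2 hcx⟩
      · exact ⟨hp, hpc⟩
  rw [this, Set.ncard_pair hxp]

lemma orient_mul_neg_of_crossing {v y a z : Plane} (ha : orient v y a ≠ 0)
    (h : (openSegment ℝ v y ∩ openSegment ℝ a z).Nonempty) :
    orient v y a * orient v y z < 0 := by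
  simp only [openSegment_eq_image_lineMap] at h
  obtain ⟨m, ⟨t, -, rfl⟩, s, ⟨hs0, hs1⟩, hs⟩ := h
  have e := orient_lineMap v y v y t
  rw [← hs, orient_lineMap, orient_self_left, orient_self_right] at e
  have h1 : s * (orient v y a * orient v y z) = -((1 - s) * (orient v y a) ^ 2) := by
    linear_combination orient v y a * e
  have h2 := mul_pos (by linarith : 0 < 1 - s) (sq_pos_of_ne_zero ha)
  by_contra! h3
  linarith [mul_nonneg hs0.le h3]

/-! ### Removals forced by a crossing. -/

/-- A point `v` that considers a center removes its edge `vy` as soon as `vy` crosses a segment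
that joins one of the two points to some point of the arc. -/
lemma Run.removes_of_crossing {V : Finset Plane} (hV : GeneralPosition V) (R : Run V)
    {v y x c p a z : Plane} (hv : v ∈ V) (hC : Considers V v x c p)
    (hE : IsDelaunayEdge (nbhd V v) v y) (ha : a = x ∨ a = p) (hav : a ≠ v) (hay : a ≠ y)
    (hcv : 0 ≤ pw c (dist c x ^ 2) v) (hcy : 0 ≤ pw c (dist c x ^ 2) y)
    (hz : pw c (dist c x ^ 2) z = 0) (hzv : 1 < dist z v)
    (hcross : (openSegment ℝ v y ∩ openSegment ℝ a z).Nonempty) : R.Removes v y x c p := by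
  have hy := hE.right_mem
  have haN : a ∈ nbhd V v := by
    rcases ha with rfl | rfl
    exacts [hC.1, hC.2.2.2.1.1]
  have hca : pw c (dist c x ^ 2) a = 0 := by
    rcases ha with rfl | rfl
    exacts [by simp [pw, dist_comm], mem_boundary_diskThrough.1 hC.2.2.2.2]
  have hD := R.del_spec v hv x c p y hC hE
  have hz' := (R.z_spec v hv x c p hC).1
  have haz : a ≠ z := by rintro rfl; exact hzv.not_ge haN.2
  have hm := exists_pw_neg_of_crossing hcross haz hca hz
  have hga := hV.orient_ne_zero hv hy.1 haN.1 hE.1 hav hay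
  have hopp := orient_mul_neg_of_crossing hga hcross
  have hcr : ∀ q ∈ arc v x c, (openSegment ℝ v y ∩ openSegment ℝ a q).Nonempty := by
    intro q hq
    rw [mem_arc] at hq
    refine crossing_of_opposite hE.1 hcv hcy hm hca hq.1 ?_
    have := same_side_of_outside (w := v) (l := 1) hE.1 hcv hcy hm (pw_le_zero (by simp))
      (pw_le_zero hy.2) hz hq.1 (PlaneLDG.pw_pos hzv) (PlaneLDG.pw_pos hq.2)
    rcases pos_and_pos_or_neg_and_neg_of_mul_pos this with h | h <;> nlinarith
  have hCross : Cross v y a (R.z v x c) := by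
    refine ⟨fun h => ?_, hcr _ hz'⟩
    refine hV.not_collinear v hv y hy.1 a haN.1 hE.1 hav.symm hay.symm (h.subset ?_)
    rintro q (rfl | rfl | rfl) <;> simp
  refine ⟨hC, fun q hq => ?_, ?_⟩
  · have h0 := (mem_arc.1 hq).1
    have h1 := pw_lt_of_crossing (hcr q hq) (c := (R.del v x c y).center)
      (k := (R.del v x c y).radius ^ 2) (c' := c) (k' := dist c x ^ 2)
      (by rwa [hD.pw_left]) (by rwa [hD.pw_right]) (by rw [hca]; exact hD.pw_pos haN hav hay)
    rw [h0] at h1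
    exact hD.mem_inner.2 h1
  · rcases ha with rfl | rfl
    exacts [Or.inl hCross, Or.inr hCross]

lemma nbhd_finite (V : Finset Plane) (v : Plane) : (nbhd V v).Finite :=
  V.finite_toSet.subset fun _ h => h.1

/-- Here `y` itself is the broadcasting point, `a` is the second point on the circle, and `b` lies
on the arc. -/
lemma Run.exists_removes_of_triangle {V : Finset Plane} (hV : GeneralPosition V) (R : Run V)
    {v y a b c : Plane} (hv : v ∈ V) (hE : IsDelaunayEdge (nbhd V v) v y)
    (ha : a ∈ nbhd V y) (hb : b ∈ nbhd V y) (hav : a ∈ nbhd V v) (hbv : 1 < dist b v)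
    (hga : orient v y a ≠ 0) (hgb : orient v y b ≠ 0)
    (hac : dist a c = dist y c) (hbc : dist b c = dist y c)
    (hemp : ∀ q ∈ nbhd V y, dist y c ≤ dist q c)
    (hcross : (openSegment ℝ v y ∩ openSegment ℝ a b).Nonempty) :
    ∃ x c p, R.Removes v y x c p := by
  have hy := hE.right_mem
  have hne : a ≠ v ∧ a ≠ y := by
    constructor <;> rintro rfl
    exacts [hga (orient_self_left _ _), hga (orient_self_right _ _)]
  have hne' : b ≠ y := by rintro rfl; exact hgb (orient_self_right _ _)
  have hab : a ≠ b := by rintro rfl; exact hbv.not_ge hav.2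
  have hB : Broadcasts V y c := by
    refine ⟨a, b, ⟨ha, ⟨hy.1, by simp⟩, hb, hne.2, hab, hne'.symm, ⟨c, dist y c⟩, rfl, hac, rfl,
      hbc, ?_⟩, pi_div_three_lt_angle hcross ?_ hb.2 hbv⟩
    · rw [Set.eq_empty_iff_forall_notMem]
      rintro q ⟨hq, hq'⟩
      exact (hemp q hq).not_gt hq'
    · rw [dist_comm]; exact hy.2
  have h0 : ∀ q, dist q c = dist y c → pw c (dist c y ^ 2) q = 0 := fun q hq => by
    rw [pw, hq, dist_comm c y, sub_self]
  have hC := considers_of_circle hV hy hav hb.1 hne.2.symm hbv (h0 a hac) (h0 b hbc) hB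
  refine ⟨y, c, a, R.removes_of_crossing hV hv hC hE (Or.inr rfl) hne.1 hne.2 ?_ (h0 y rfl).ge
    (h0 b hbc) hbv hcross⟩
  rw [pw, dist_comm c y]
  exact sub_nonneg.2 (pow_le_pow_left₀ dist_nonneg
    (hemp v ⟨hv, by rw [dist_comm]; exact hy.2⟩) 2)

lemma Run.exists_removes_of_not_delaunay {V : Finset Plane} (hV : GeneralPosition V) (R : Run V)
    {v y : Plane} (hv : v ∈ V) (hE : IsDelaunayEdge (nbhd V v) v y)
    (hE' : ¬ IsDelaunayEdge (nbhd V y) y v) : ∃ x c p, R.Removes v y x c p := by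
  have hy := hE.right_mem
  have hvy1 : dist v y ≤ 1 := by rw [dist_comm]; exact hy.2
  obtain ⟨a, ha, b, hb, c, hga, hgb, hac, hbc, hemp, hcross⟩ :=
    exists_delaunay_triangle_crossing (nbhd_finite V y) ⟨hv, hvy1⟩ ⟨hy.1, by simp⟩ hE.1
      (fun q hq h1 h2 => hV.orient_ne_zero hy.1 hv hq.1 hE.1.symm h2 h1) hE'
  have hga' : orient v y a ≠ 0 := by rw [orient_swap]; exact neg_ne_zero.2 hga.ne'
  have hgb' : orient v y b ≠ 0 := by rw [orient_swap]; exact neg_ne_zero.2 hgb.ne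
  have hne : ∀ q, orient v y q ≠ 0 → q ≠ v ∧ q ≠ y := by
    intro q hq
    constructor <;> rintro rfl
    exacts [hq (orient_self_left _ _), hq (orient_self_right _ _)]
  have hcv : 0 ≤ pw c (dist y c ^ 2) v :=
    sub_nonneg.2 (pow_le_pow_left₀ dist_nonneg (hemp v ⟨hv, hvy1⟩) 2)
  have hcy : pw c (dist y c ^ 2) y = 0 := sub_self _
  have hca : pw c (dist y c ^ 2) a = 0 := by rw [pw, hac, sub_self]
  have hcb : pw c (dist y c ^ 2) b = 0 := by rw [pw, hbc, sub_self]
  rcases le_or_gt (dist a v) 1 with hav | hav <;> rcases le_or_gt (dist b v) 1 with hbv | hbv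
  -- With both `a` and `b` in `N_v`, the disk certifying `vy` in `LDT(v)` would contain one of them.
  · obtain ⟨D, hD⟩ := hE.2
    have h1 := pw_lt_of_crossing hcross (c := D.center) (k := D.radius ^ 2) (c' := c)
      (k' := dist y c ^ 2) (by rwa [hD.pw_left]) (by rw [hD.pw_right, hcy])
      (by rw [hca]; exact hD.pw_pos ⟨ha.1, hav⟩ (hne a hga').1 (hne a hga').2)
    have h2 := hD.pw_pos ⟨hb.1, hbv⟩ (hne b hgb').1 (hne b hgb').2
    linarith
  · exact R.exists_removes_of_triangle hV hv hE ha hb ⟨ha.1, hav⟩ hbv hga' hgb' hac hbc hemp hcross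
  · refine R.exists_removes_of_triangle hV hv hE hb ha ⟨hb.1, hbv⟩ hav hgb' hga' hbc hac hemp ?_
    rwa [openSegment_symm ℝ b a]
  -- With both far from `v`, the disk with diameter `vy` takes the role of the certifying disk.
  · have hd : dist v y ^ 2 ≤ 1 := pow_le_one₀ dist_nonneg hvy1
    have hf : ∀ q, 1 < dist q v → 0 < pw (midpoint ℝ v y) (dist v y ^ 2 / 4) q := by
      intro q hq
      rw [pw_eq_inner]
      have h1 : 1 < dist q v ^ 2 := one_lt_pow₀ hq two_ne_zero
      have h2 := sq_nonneg (dist q y)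
      linarith
    have h1 := pw_lt_of_crossing hcross (c := midpoint ℝ v y) (k := dist v y ^ 2 / 4) (c' := c)
      (k' := dist y c ^ 2) (by rw [pw_eq_inner]; simpa using hcv)
      (by rw [pw_eq_inner, hcy, dist_comm y v]; simp)
      (by rw [hca]; exact hf a hav)
    have h2 := hf b hbv
    linarith

lemma Cross.orient_ne_zero {v y a z : Plane} (hvy : v ≠ y) (h : Cross v y a z) :
    orient v y a ≠ 0 := by
  obtain ⟨hcol, h⟩ := h
  intro h0
  apply hcol
  simp only [openSegment_eq_image_lineMap] at h
  obtain ⟨m, ⟨t, -, rfl⟩, s, ⟨hs0, hs1⟩, hs⟩ := h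
  have e := orient_lineMap v y v y t
  rw [← hs, orient_lineMap, orient_self_left, orient_self_right, h0] at e
  have hz : orient v y z = 0 := by
    have : s * orient v y z = 0 := by linarith
    exact (mul_eq_zero.1 this).resolve_left hs0.ne'
  obtain ⟨α, rfl⟩ := exists_lineMap_of_orient_eq_zero hvy h0
  obtain ⟨β, rfl⟩ := exists_lineMap_of_orient_eq_zero hvy hz
  rw [collinear_iff_of_mem (p₀ := v) (by simp)]
  refine ⟨y - v, ?_⟩
  rintro p (rfl | rfl | rfl | rfl)
  · exact ⟨0, by simp⟩
  · exact ⟨1, by simp⟩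
  · exact ⟨α, by simp [AffineMap.lineMap_apply]⟩
  · exact ⟨β, by simp [AffineMap.lineMap_apply]⟩

/-- The same center works for `y`: the third triangle vertex `z` is also far from `y`, while `x` and
`p` are neighbors of `y`, and `xz` crosses `vy`. -/
lemma Run.removes_symm {V : Finset Plane} (hV : GeneralPosition V) (R : Run V)
    {v y x c p : Plane} (hv : v ∈ V) (hE : IsDelaunayEdge (nbhd V v) v y)
    (hE' : IsDelaunayEdge (nbhd V y) y v) (hR : R.Removes v y x c p) :
    R.Removes y v x c p := by
  have hy := hE.right_mem
  have hvy1 : dist v y ≤ 1 := by rw [dist_comm]; exact hy.2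
  have hvy := hE.1
  obtain ⟨hC, harc, hcross⟩ := hR
  have hD := R.del_spec v hv x c p y hC hE
  have hz' := mem_arc.1 (R.z_spec v hv x c p hC).1
  obtain ⟨hxN, hB, hcard, ⟨hpN, hpx⟩, hpC⟩ := hC
  have hpx : p ≠ x := hpx
  have hcx : pw c (dist c x ^ 2) x = 0 := by simp [pw, dist_comm]
  have hcp := mem_boundary_diskThrough.1 hpC
  -- the third vertex of the broadcast triangle
  obtain ⟨z, hzx, hpxN, hxz, hcz, hzv⟩ : ∃ z ∈ nbhd V x, p ∈ nbhd V x ∧ x ≠ z ∧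
      pw c (dist c x ^ 2) z = 0 ∧ 1 < dist z v := by
    obtain ⟨u, w, hF, -⟩ := hB
    obtain ⟨hcu, hcw⟩ := hF.pw_eq_zero
    obtain ⟨huN, -, hwN, hux, huw, hxw, -⟩ := hF
    have hsub : ∀ q ∈ nbhd V v, pw c (dist c x ^ 2) q = 0 → q = x ∨ q = p := by
      obtain ⟨s, t, hst, he⟩ := Set.ncard_eq_two.1 hcard
      intro q hq hcq
      have h1 : q ∈ nbhd V v ∩ (diskThrough c x).boundary :=
        ⟨hq, mem_boundary_diskThrough.2 hcq⟩
      have h2 : x ∈ nbhd V v ∩ (diskThrough c x).boundary :=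
        ⟨hxN, mem_boundary_diskThrough.2 hcx⟩
      have h3 : p ∈ nbhd V v ∩ (diskThrough c x).boundary := ⟨hpN, hpC⟩
      rw [he] at h1 h2 h3
      simp only [Set.mem_insert_iff, Set.mem_singleton_iff] at h1 h2 h3
      grind
    -- As no four points are cocircular, `p` is a vertex of the broadcast triangle; the remaining
    -- vertex is far from `v`, since `N_v` has only two points on the circle.
    rcases hV.eq_of_pw_eq_zero hxN.1 huN.1 hwN.1 hpN.1 hux.symm hxw huw hcx hcu hcw hcp with
      h | h | h
    · exact (hpx h).elim
    · subst h
      refine ⟨w, hwN, huN, hxw, hcw, ?_⟩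
      by_contra! h
      rcases hsub w ⟨hwN.1, h⟩ hcw with h | h
      exacts [hxw h.symm, huw h.symm]
    · subst h
      refine ⟨u, huN, hwN, hux.symm, hcu, ?_⟩
      by_contra! h
      rcases hsub u ⟨huN.1, h⟩ hcu with h | h
      exacts [hux h, huw h]
  have hemp : ∀ q ∈ nbhd V x, 0 ≤ pw c (dist c x ^ 2) q := by
    obtain ⟨u, w, hF, -⟩ := hB
    exact fun q hq => hF.pw_nonneg hq
  have hxz1 : dist x z ≤ 1 := by rw [dist_comm]; exact hzx.2
  have hcv : 0 ≤ pw c (dist c x ^ 2) v := hemp v ⟨hv, by rw [dist_comm]; exact hxN.2⟩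
  have hDz := hD.mem_inner.1 (harc (mem_arc.2 ⟨hcz, hzv⟩))
  have hDz' := hD.mem_inner.1 (harc (mem_arc.2 hz'))
  -- The broadcast circle is known to be empty only of points of `N_x`, so a `y` far from `x` needs
  -- the separate geometric argument.
  have hcy : 0 ≤ pw c (dist c x ^ 2) y := by
    rcases le_or_gt (dist x y) 1 with h | h
    · exact hemp y ⟨hy.1, by rwa [dist_comm]⟩
    · exact pw_nonneg_of_far hvy hcx hcz hcv hD.pw_left hD.pw_right (hD.pw_nonneg hxN) hDz hvy1
        hxN.2 hxz1 hzv h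
  have hzne : z ≠ v ∧ z ≠ y := by
    constructor <;> rintro rfl
    · rw [dist_self] at hzv; linarith
    · exact hDz.ne hD.pw_right
  -- the chosen point of the arc may be replaced by `z`
  obtain ⟨a, ha, hcr'⟩ : ∃ a, (a = x ∨ a = p) ∧ Cross v y a (R.z v x c) := by
    rcases hcross with h | h
    exacts [⟨x, Or.inl rfl, h⟩, ⟨p, Or.inr rfl, h⟩]
  have haN : a ∈ nbhd V v := by rcases ha with rfl | rfl <;> assumption
  have hca : pw c (dist c x ^ 2) a = 0 := by rcases ha with rfl | rfl <;> assumption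
  have haz' : a ≠ R.z v x c := by
    intro h
    rw [← h] at hz'
    exact hz'.2.not_ge haN.2
  have hm := exists_pw_neg_of_crossing hcr'.2 haz' hca hz'.1
  have hga := hcr'.orient_ne_zero hvy
  have hne : a ≠ v ∧ a ≠ y := by
    constructor <;> rintro rfl
    exacts [hga (orient_self_left _ _), hga (orient_self_right _ _)]
  have hside := same_side_of_outside (w := v) (l := 1) hvy hcv hcy hm (pw_le_zero (by simp))
    (pw_le_zero hy.2) hz'.1 hcz (PlaneLDG.pw_pos hz'.2) (PlaneLDG.pw_pos hzv)
  have hopp' := orient_mul_neg_of_crossing hga hcr'.2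
  have hopp : orient v y a * orient v y z < 0 := by
    rcases pos_and_pos_or_neg_and_neg_of_mul_pos hside with h | h <;> nlinarith
  have hcr := crossing_of_opposite hvy hcv hcy hm hca hcz hopp
  -- no point of the circle in the neighborhood of `v` is on the same side as `z`
  have hfar : ∀ q ∈ nbhd V v, pw c (dist c x ^ 2) q = 0 → orient v y q * orient v y z ≤ 0 := by
    intro q hq hcq
    by_contra! h
    have h1 : orient v y a * orient v y q < 0 := by
      rcases pos_and_pos_or_neg_and_neg_of_mul_pos h with h | h <;> nlinarith
    have h2 := pw_lt_of_crossing (crossing_of_opposite hvy hcv hcy hm hca hcq h1)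
      (c := (R.del v x c y).center) (k := (R.del v x c y).radius ^ 2) (c' := c)
      (k' := dist c x ^ 2) (by rwa [hD.pw_left]) (by rwa [hD.pw_right])
      (by rw [hca]; exact hD.pw_pos haN hne.1 hne.2)
    rw [hcq] at h2
    exact h2.not_ge (hD.pw_nonneg hq)
  -- a chord of the circle that crosses `vy` has an endpoint far from `y`
  have hchord : ∀ q ∈ nbhd V y, q ≠ v → q ≠ y → pw c (dist c x ^ 2) q = 0 →
      (openSegment ℝ v y ∩ openSegment ℝ q z).Nonempty → 1 < dist z y := by
    intro q hq hqv hqy hcq hqz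
    by_contra! h
    obtain ⟨D', hD'⟩ := hE'.2
    have h1 := pw_lt_of_crossing hqz (c := D'.center) (k := D'.radius ^ 2) (c' := c)
      (k' := dist c x ^ 2) (by rwa [hD'.pw_right]) (by rwa [hD'.pw_left])
      (by rw [hcq]; exact hD'.pw_pos hq hqy hqv)
    rw [hcz] at h1
    exact h1.not_ge (hD'.pw_nonneg ⟨hzx.1, h⟩)
  have hxv : x ≠ v := by rintro rfl; exact hzv.not_ge hzx.2
  have hxy : x ≠ y := by
    rintro rfl
    -- If `x = y`, the crossing chord must start at `p`; then `z` is far from `y`, although it is a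
    -- neighbor of `x`.
    obtain rfl : a = p := ha.resolve_left hne.2
    exact (hchord a hpxN hne.1 hne.2 hca hcr).not_ge hzx.2
  have hgz : orient v y z ≠ 0 := fun h => by simp [h] at hopp
  have hgx := hV.orient_ne_zero hv hy.1 hxN.1 hvy hxv hxy
  have hcrx := crossing_of_opposite hvy hcv hcy hm hcx hcz
    ((hfar x hxN hcx).lt_of_ne (mul_ne_zero hgx hgz))
  have hxy1 : dist x y ≤ 1 := by
    obtain ⟨m, h1, h2⟩ := hcrx
    have := dist_add_dist_le_of_crossing (openSegment_subset_segment ℝ _ _ h1)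
      (openSegment_subset_segment ℝ _ _ h2)
    linarith
  have hzy := hchord x ⟨hxN.1, hxy1⟩ hxv hxy hcx hcrx
  -- If `p` were far from `y`, it would lie on the same side of `vy` as `z`, contrary to `hfar`.
  have hpy : dist p y ≤ 1 := by
    by_contra! h
    exact (hfar p hpN hcp).not_gt (same_side_of_outside (w := y) (l := 1) hvy hcv hcy hm
      (pw_le_zero hvy1) (pw_le_zero (by simp)) hcp hcz (PlaneLDG.pw_pos h) (PlaneLDG.pw_pos hzy))
  have hC' := considers_of_circle hV ⟨hxN.1, hxy1⟩ ⟨hpN.1, hpy⟩ hzx.1 hpx.symm hzy hcp hcz hB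
  exact R.removes_of_crossing hV hy.1 hC' hE' (Or.inl rfl) hxy hxv hcy hcv hcz hzy
    (by rwa [openSegment_symm ℝ y v])

/-! ### Consistency of the final edge sets. -/

lemma Run.mem_E {V : Finset Plane} (R : Run V) {v y : Plane} (hvy : v ≠ y) :
    s(v, y) ∈ R.E v ↔
      IsDelaunayEdge (nbhd V v) v y ∧ ¬ ∃ x c p, R.Removes v y x c p := by
  constructor
  · rintro ⟨y', h, h'⟩
    obtain rfl : y = y' := by
      rcases Sym2.eq_iff.1 h with ⟨-, h⟩ | ⟨h, h'⟩
      exacts [h, (hvy h'.symm).elim]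
    exact h'
  · exact fun h => ⟨y, rfl, h⟩

lemma Run.mem_E_of_mem_E {V : Finset Plane} (hV : GeneralPosition V) (R : Run V) {v y : Plane}
    (hv : v ∈ V) (hy : y ∈ V) (hvy : v ≠ y) (h : s(v, y) ∈ R.E v) : s(v, y) ∈ R.E y := by
  rw [R.mem_E hvy] at h
  rw [Sym2.eq_swap, R.mem_E hvy.symm]
  obtain ⟨hE, hR⟩ := h
  have hE' : IsDelaunayEdge (nbhd V y) y v := by
    by_contra hE'
    exact hR (R.exists_removes_of_not_delaunay hV hv hE hE')
  refine ⟨hE', ?_⟩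
  rintro ⟨x, c, p, h⟩
  exact hR ⟨x, c, p, R.removes_symm hV hy hE' hE h⟩

end PlaneLDG

theorem lemma7 (V : Finset PlaneLDG.Plane) (hV : PlaneLDG.GeneralPosition V)
    (R : PlaneLDG.Run V) (v y : PlaneLDG.Plane) (hv : v ∈ V) (hy : y ∈ V) (hvy : v ≠ y) :
    s(v, y) ∈ R.E v ↔ s(v, y) ∈ R.E y := by
  refine ⟨R.mem_E_of_mem_E hV hv hy hvy, fun h => ?_⟩
  rw [Sym2.eq_swap] at h ⊢
  exact R.mem_E_of_mem_E hV hy hv hvy.symm h
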